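/- Rings are associative with $1\neq 0$. A multiplicative subset $S$ of a ring $R$ (so $1\in S$, $0\notin S$) is a *left Ore set* if $Sr\cap Rs\neq\emptyset$ for all $r\in R$, $s\in S$; put $\mathrm{ass}(S)=\{r\in R : sr=0 \text{ for some } s\in S\}$. A left Ore set $S$ is a *left denominator set* if $rs=0$ with $r\in R$, $s\in S$ implies $r\in\mathrm{ass}(S)$; then $S^{-1}R$ denotes the left localization. Let $\mathrm{maxDen}_l(R)$ be the set of left denominator sets of $R$ that are maximal under inclusion, let $\mathcal L_l(R)$ be the union of all left denominator sets of $R$, and call $R$ *weakly left localizable* if every non-nilpotent element of $R$ lies in $\mathcal L_l(R)$. Let $Q_{l,cl}(R)=\mathcal C_R^{-1}R$ be the classical left quotient ring ($\mathcal C_R$ is the set of two-sided regular elements; the ring exists iff $\mathcal C_R$ is a left denominator set), and let $Q_l(R)=S_{l,0}(R)^{-1}R$ be the largest left quotient ring, where $S_{l,0}(R)$ is the largest left denominator set $S$ with $\mathrm{ass}(S)=0$ (it always exists). Let $\mathrm{rad}$ denote the Jacobson radical and $\mathcal N_A$ the nil radical (the sum of all two-sided nil ideals) of a ring $A$. **Theorem.**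 Let $R$ be a ring, let $\mathfrak l=\bigcap_{S\in\mathrm{maxDen}_l(R)}\mathrm{ass}(S)$ be its left localization radical, and let $\pi':R\to R'=R/\mathfrak l$ be the quotient map. The following statements are equivalent. 1. $R$ is a weakly left localizable ring such that (a) the map $\mathrm{maxDen}_l(R)\to\mathrm{maxDen}_l(R')$, $S\mapsto\pi'(S)$, is surjective; (b) $|\mathrm{maxDen}_l(R)|<\infty$; (c) for every $S\in\mathrm{maxDen}_l(R)$ the ring $S^{-1}R$ is weakly left localizable; (d) for all $S,T\in\mathrm{maxDen}_l(R)$ with $S\neq T$, the ideal $\mathrm{ass}(S)$ is not nil modulo $\mathrm{ass}(T)$, i.e. some $a\in\mathrm{ass}(S)$ satisfies $a^k\notin\mathrm{ass}(T)$ for all $k$. 2. $Q_{l,cl}(R')$ exists and $Q_{l,cl}(R')\simeq\prod_{i=1}^n R_i$ for some $n$ and some local rings $R_i$ with $\mathrm{rad}(R_i)=\mathcal N_{R_i}$; $\mathfrak l$ is a nil ideal; and $\pi'(\mathcal L_l(R))=\mathcal L_l(R')$. 3. $Q_l(R')\simeq\prod_{i=1}^n R_i$ for some $n$ and some local rings $R_i$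 with $\mathrm{rad}(R_i)=\mathcal N_{R_i}$; $\mathfrak l$ is a nil ideal; and $\pi'(\mathcal L_l(R))=\mathcal L_l(R')$. -/

import Mathlib

/-! Left Ore and denominator sets, left localization radical, left quotient rings of an
associative unital ring. -/

universe u

namespace LeftLoc

section Basic

variable {R : Type u} [Ring R]

/-- A left Ore set: a multiplicative subset `S` with `1 ∈ S`, `0 ∉ S` and `S r ∩ R s ≠ ∅`
for all `r ∈ R`, `s ∈ S`. -/
structure IsLeftOreSet (S : Submonoid R) : Prop where
  zero_notMem : (0 : R) ∉ S
  ore : ∀ (r : R), ∀ s ∈ S, ∃ s' ∈ S, ∃ r' : R, s' * r = r' * s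

/-- `ass(S) = {r | s r = 0 for some s ∈ S}`. -/
def ass (S : Submonoid R) : Set R := {r | ∃ s ∈ S, s * r = 0}

/-- A left denominator set: a left Ore set such that `r s = 0` with `s ∈ S` implies
`r ∈ ass(S)`. -/
structure IsLeftDenominatorSet (S : Submonoid R) : Prop extends IsLeftOreSet S where
  reversible : ∀ (r : R), ∀ s ∈ S, r * s = 0 → r ∈ ass S

theorem IsLeftOreSet.add_mem_ass {S : Submonoid R} (h : IsLeftOreSet S) {a b : R}
    (ha : a ∈ ass S) (hb : b ∈ ass S) : a + b ∈ ass S := by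
  obtain ⟨s, hs, hsa⟩ := ha
  obtain ⟨t, ht, htb⟩ := hb
  obtain ⟨s', hs', r', e⟩ := h.ore t s hs
  refine ⟨s' * t, S.mul_mem hs' ht, ?_⟩
  rw [mul_add, mul_assoc s' t b, htb, e, mul_assoc, hsa]
  simp

theorem IsLeftOreSet.mul_mem_ass {S : Submonoid R} (h : IsLeftOreSet S) (x : R) {a : R}
    (ha : a ∈ ass S) : x * a ∈ ass S := by
  obtain ⟨s, hs, hsa⟩ := ha
  obtain ⟨s', hs', r', e⟩ := h.ore x s hs
  exact ⟨s', hs', by rw [← mul_assoc, e, mul_assoc, hsa, mul_zero]⟩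

theorem mul_mem_ass_right {S : Submonoid R} {a : R} (ha : a ∈ ass S) (x : R) :
    a * x ∈ ass S := by
  obtain ⟨s, hs, hsa⟩ := ha
  exact ⟨s, hs, by rw [← mul_assoc, hsa, zero_mul]⟩

theorem zero_mem_ass (S : Submonoid R) : (0 : R) ∈ ass S := ⟨1, S.one_mem, by simp⟩

/-- A left denominator set is an Ore set in the sense of Mathlib. -/
theorem IsLeftDenominatorSet.nonempty_oreSet {S : Submonoid R} (h : IsLeftDenominatorSet S) :
    Nonempty (OreLocalization.OreSet S) := by
  refine OreLocalization.nonempty_oreSet_iff.2 ⟨fun a b s e => ?_, fun r s => ?_⟩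
  · obtain ⟨t, ht, e'⟩ := h.reversible (a - b) s s.2 (by rw [sub_mul, e, sub_self])
    exact ⟨⟨t, ht⟩, by rw [mul_sub, sub_eq_zero] at e'; exact e'⟩
  · obtain ⟨s', hs', r', e⟩ := h.ore r s s.2
    exact ⟨r', ⟨s', hs'⟩, e⟩

/-- The Ore data of a left denominator set. -/
@[reducible]
noncomputable def IsLeftDenominatorSet.oreSet {S : Submonoid R} (h : IsLeftDenominatorSet S) :
    OreLocalization.OreSet S := Classical.choice h.nonempty_oreSet

/-- The left localization `S⁻¹R` of `R` at a left denominator set `S`. -/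
def LeftLocalization (S : Submonoid R) (h : IsLeftDenominatorSet S) : Type u :=
  letI := h.oreSet
  OreLocalization S R

noncomputable instance (S : Submonoid R) (h : IsLeftDenominatorSet S) :
    Ring (LeftLocalization S h) :=
  letI := h.oreSet
  inferInstanceAs (Ring (OreLocalization S R))

end Basic

section Invariants

variable (R : Type u) [Ring R]

/-- `maxDen_l(R)`: the set of maximal left denominator sets of `R`. -/
def maxDen : Set (Submonoid R) := {S | Maximal IsLeftDenominatorSet S}

/-- The set of left localizable elements of `R`. -/
def localizable : Set R := {r | ∃ S : Submonoid R, IsLeftDenominatorSet S ∧ r ∈ S}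

/-- `R` is weakly left localizable: every non-nilpotent element is left localizable. -/
def IsWeaklyLeftLocalizable : Prop := ∀ r : R, ¬ IsNilpotent r → r ∈ localizable R

/-- The left localization radical of `R`: the intersection of the ideals `ass(S)` over all
maximal left denominator sets `S`. -/
def locRadical : Ideal R where
  carrier := ⋂ S ∈ maxDen R, ass S
  zero_mem' := by
    simp only [Set.mem_iInter]
    exact fun S _ => zero_mem_ass S
  add_mem' := by
    simp only [Set.mem_iInter]
    exact fun ha hb S hS => hS.prop.add_mem_ass (ha S hS) (hb S hS)
  smul_mem' := by
    simp only [Set.mem_iInter]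
    exact fun x a ha S hS => hS.prop.mul_mem_ass x (ha S hS)

variable {R} in
theorem mem_locRadical {r : R} : r ∈ locRadical R ↔ ∀ S ∈ maxDen R, r ∈ ass S := by
  change r ∈ (⋂ S ∈ maxDen R, ass S) ↔ _
  simp only [Set.mem_iInter]

instance : (locRadical R).IsTwoSided where
  mul_mem_of_left x ha := mem_locRadical.2 fun S hS =>
    mul_mem_ass_right (mem_locRadical.1 ha S hS) x

/-- The image of a left denominator set `S` under `R → R / 𝔩` is a left denominator set if
`𝔩 ⊆ ass(S)`; for maximal `S` it is again maximal. -/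
theorem map_mem_maxDen {S : Submonoid R} (hS : S ∈ maxDen R) :
    S.map (Ideal.Quotient.mk (locRadical R)) ∈ maxDen (R ⧸ locRadical R) := by
  have hl : ∀ x : R, Ideal.Quotient.mk (locRadical R) x = 0 → x ∈ ass S := fun x hx =>
    mem_locRadical.1 (Ideal.Quotient.eq_zero_iff_mem.1 hx) S hS
  refine ⟨⟨⟨?_, ?_⟩, ?_⟩, ?_⟩
  · rintro ⟨s, hs, h0⟩
    obtain ⟨t, ht, e⟩ := hl s h0
    exact hS.prop.zero_notMem (e ▸ S.mul_mem ht hs)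
  · rintro r _ ⟨s, hs, rfl⟩
    obtain ⟨r, rfl⟩ := Ideal.Quotient.mk_surjective r
    obtain ⟨s', hs', r', e⟩ := hS.prop.ore r s hs
    refine ⟨_, ⟨s', hs', rfl⟩, Ideal.Quotient.mk _ r', ?_⟩
    rw [← map_mul, e, map_mul]
  · rintro r _ ⟨s, hs, rfl⟩ h0
    obtain ⟨r, rfl⟩ := Ideal.Quotient.mk_surjective r
    obtain ⟨u, hu, e⟩ := hl (r * s) (by rw [map_mul]; exact h0)
    obtain ⟨t, ht, e'⟩ := hS.prop.reversible (u * r) s hs (by rw [mul_assoc, e])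
    refine ⟨_, ⟨t * u, S.mul_mem ht hu, rfl⟩, ?_⟩
    change Ideal.Quotient.mk _ (t * u) * _ = 0
    rw [← map_mul, mul_assoc, e', map_zero]
  · intro T hT hST
    have hle : S ≤ T.comap (Ideal.Quotient.mk (locRadical R)) :=
      Submonoid.map_le_iff_le_comap.1 hST
    have hden : IsLeftDenominatorSet (T.comap (Ideal.Quotient.mk (locRadical R))) := by
      refine ⟨⟨?_, ?_⟩, ?_⟩
      · intro h0
        rw [Submonoid.mem_comap, map_zero] at h0
        exact hT.zero_notMem h0
      · intro r s hs
        obtain ⟨t, ht, r', e⟩ := hT.ore (Ideal.Quotient.mk _ r) _ hs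
        obtain ⟨t, rfl⟩ := Ideal.Quotient.mk_surjective t
        obtain ⟨r', rfl⟩ := Ideal.Quotient.mk_surjective r'
        obtain ⟨u, hu, e'⟩ := hl (t * r - r' * s)
          (by rw [map_sub, map_mul, map_mul]; exact sub_eq_zero.2 e)
        refine ⟨u * t, Submonoid.mul_mem _ (hle hu) ht, u * r', ?_⟩
        rw [mul_sub, sub_eq_zero] at e'
        rw [mul_assoc, e', mul_assoc]
      · intro r s hs h0
        obtain ⟨t, ht, e⟩ := hT.reversible (Ideal.Quotient.mk _ r) _ hs
          (by
            rw [← map_mul, h0, map_zero])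
        obtain ⟨t, rfl⟩ := Ideal.Quotient.mk_surjective t
        obtain ⟨u, hu, e'⟩ := hl (t * r) (by rw [map_mul]; exact e)
        exact ⟨u * t, Submonoid.mul_mem _ (hle hu) ht, by rw [mul_assoc, e']⟩
    intro x hx
    obtain ⟨x, rfl⟩ := Ideal.Quotient.mk_surjective x
    exact ⟨x, hS.le_of_ge hden hle hx, rfl⟩

/-- The map `maxDen_l(R) → maxDen_l(R/𝔩)`, `S ↦ π'(S)`, where `𝔩` is the left localization
radical and `π' : R → R/𝔩` is the quotient map. -/
def maxDenMap (S : maxDen R) : maxDen (R ⧸ locRadical R) :=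
  ⟨(S : Submonoid R).map (Ideal.Quotient.mk (locRadical R)), map_mem_maxDen R S.2⟩

/-- `S_{l,0}(R)`: the largest element of the poset `Den_l(R, 0)` of left denominator sets `S`
with `ass(S) = 0`, built as the submonoid generated by all of them. -/
def largestRegularDen : Submonoid R :=
  sSup {S | IsLeftDenominatorSet S ∧ ass S = {0}}

theorem largestRegularDen_ore (r s : R) (hs : s ∈ largestRegularDen R) :
    ∃ s' ∈ largestRegularDen R, ∃ r' : R, s' * r = r' * s := by
  rw [largestRegularDen, sSup_eq_iSup', Submonoid.iSup_eq_closure] at hs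
  induction hs using Submonoid.closure_induction generalizing r with
  | mem s h =>
    obtain ⟨⟨S, hS⟩, hsS⟩ := Set.mem_iUnion.1 h
    obtain ⟨s', hs', r', e⟩ := hS.1.ore r s hsS
    exact ⟨s', le_sSup (a := S) hS hs', r', e⟩
  | one => exact ⟨1, Submonoid.one_mem _, r, by simp⟩
  | mul a b _ _ iha ihb =>
    obtain ⟨t, ht, r', e⟩ := ihb r
    obtain ⟨t', ht', r'', e'⟩ := iha r'
    exact ⟨t' * t, Submonoid.mul_mem _ ht' ht, r'', by
      rw [mul_assoc, e, ← mul_assoc, e', mul_assoc]⟩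

theorem largestRegularDen_le : largestRegularDen R ≤ nonZeroDivisors R := by
  refine sSup_le fun S hS s hs => ?_
  refine mem_nonZeroDivisors_iff.2 ⟨fun x hx => ?_, fun x hx => ?_⟩
  · have : x ∈ ass S := ⟨s, hs, hx⟩
    rw [hS.2] at this
    exact this
  · have := hS.1.reversible x s hs hx
    rw [hS.2] at this
    exact this

/-- `S_{l,0}(R)` is indeed the largest element of `Den_l(R, 0)`. -/
theorem largestRegularDen_isGreatest [Nontrivial R] :
    IsGreatest {S | IsLeftDenominatorSet S ∧ ass S = {0}} (largestRegularDen R) := by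
  refine ⟨⟨⟨⟨fun h => ?_, largestRegularDen_ore R⟩, fun r s hs h => ?_⟩, ?_⟩,
    fun S hS => le_sSup hS⟩
  · exact zero_notMem_nonZeroDivisors (largestRegularDen_le R h)
  · rw [(mem_nonZeroDivisors_iff.1 (largestRegularDen_le R hs)).2 r h]
    exact zero_mem_ass _
  · refine Set.Subset.antisymm ?_ (by rintro _ rfl; exact zero_mem_ass _)
    rintro r ⟨s, hs, h⟩
    exact (mem_nonZeroDivisors_iff.1 (largestRegularDen_le R hs)).1 r h

theorem largestRegularDen_nonempty_oreSet :
    Nonempty (OreLocalization.OreSet (largestRegularDen R)) := by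
  refine OreLocalization.nonempty_oreSet_iff.2 ⟨fun a b s e => ⟨1, ?_⟩, fun r s => ?_⟩
  · have := (mem_nonZeroDivisors_iff.1 (largestRegularDen_le R s.2)).2 (a - b)
      (by rw [sub_mul, e, sub_self])
    rw [sub_eq_zero.1 this]
  · obtain ⟨s', hs', r', e⟩ := largestRegularDen_ore R r s s.2
    exact ⟨r', ⟨s', hs'⟩, e⟩

/-- The Ore data of `S_{l,0}(R)`. -/
@[reducible]
noncomputable def largestRegularDenOreSet : OreLocalization.OreSet (largestRegularDen R) :=
  Classical.choice (largestRegularDen_nonempty_oreSet R)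

/-- `Q_l(R) = S_{l,0}(R)⁻¹R`, the largest left quotient ring of `R`. -/
def LargestLeftQuotientRing : Type u :=
  letI := largestRegularDenOreSet R
  OreLocalization (largestRegularDen R) R

noncomputable instance : Ring (LargestLeftQuotientRing R) :=
  letI := largestRegularDenOreSet R
  inferInstanceAs (Ring (OreLocalization (largestRegularDen R) R))

/-- The nil radical of `R`: the sum of all nil (two-sided) ideals of `R`. -/
def nilRad : Ideal R := sSup {I | I.IsTwoSided ∧ ∀ x ∈ I, IsNilpotent x}

/-- `R` is isomorphic to a product of finitely many local rings, each of which has its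
(Jacobson) radical equal to its nil radical. -/
def IsFiniteProdOfNilLocal : Prop :=
  ∃ (n : ℕ) (A : Fin n → Type u) (_ : ∀ i, Ring (A i)),
    (∀ i, IsLocalRing (A i) ∧ Ring.jacobson (A i) = nilRad (A i)) ∧
      Nonempty (R ≃+* ∀ i, A i)

end Invariants

end LeftLoc

/-! Everything turns on one property of `R' = R/𝔩`: being a left order in a finite product of rings
whose elements are all nilpotent or invertible (`IsLeftOrderInProd`). Such rings are exactly the
local rings whose Jacobson radical is the nil radical. In such an order the regular elements are
those inverted in the product (`unitPreimage_eq_nonZeroDivisors`), so both quotient rings are that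
product, and 2 and 3 have the same content.

From 1: a maximal denominator set consists of all elements inverted in its localization. As
localizations compose, localizable elements of `S⁻¹R` are units, so (c) makes each `S⁻¹R`
nil-or-unit. `R'` embeds in their product, finite by (b), and (d) yields elements separating the
factors, from which common denominators are built (`isLeftLocalizationMap_pi`). Weak localizability
makes `𝔩` nil; (a) gives equality of the localizable images.

Conversely, the maximal denominator sets of `R'` are the inverted sets of the components
(`mem_maxDen_iff_of_injective`). Equality of localizable images and nilness of `𝔩` carry this back
to `R`; elements supported on one factor give (a) and (d). -/

namespace LeftLoc

/-! ### Left localization maps and their inverted sets -/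

section LocalizationMap

variable {R : Type*} [Ring R] {B : Type*} [Ring B] {C : Type*} [Ring C]

/-- The elements of `R` that become units under `f`. -/
def unitPreimage (f : R →+* B) : Submonoid R := (IsUnit.submonoid B).comap f

theorem mem_unitPreimage {f : R →+* B} {r : R} : r ∈ unitPreimage f ↔ IsUnit (f r) := Iff.rfl

/-- A ring homomorphism `f : R → B` that exhibits `B` as the left localization of `R` at the
set of elements inverted by `f`. -/
structure IsLeftLocalizationMap (f : R →+* B) : Prop where
  exists_mul_eq : ∀ b, ∃ p r, IsUnit (f p) ∧ f p * b = f r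
  exists_mul_eq_zero : ∀ r, f r = 0 → ∃ p, IsUnit (f p) ∧ p * r = 0

namespace IsLeftLocalizationMap

theorem comp {g : B →+* C} {f : R →+* B} (hg : IsLeftLocalizationMap g)
    (hf : IsLeftLocalizationMap f) : IsLeftLocalizationMap (g.comp f) := by
  refine ⟨fun c => ?_, fun r hr => ?_⟩
  · obtain ⟨b₁, b₂, hb, e⟩ := hg.exists_mul_eq c
    obtain ⟨p₁, r₁, hp₁, e₁⟩ := hf.exists_mul_eq b₁
    obtain ⟨p₂, r₂, hp₂, e₂⟩ := hf.exists_mul_eq (f p₁ * b₂)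
    -- Here `c = g(b₁)⁻¹ g(b₂)`. Multiplying `b₁` and `b₂` by `f p₁` turns `b₁` into `f r₁`, and
    -- `p₂` then clears the denominator of `f p₁ * b₂`.
    refine ⟨p₂ * r₁, r₂, ?_, ?_⟩
    · rw [RingHom.comp_apply, map_mul, ← e₁]
      simpa only [map_mul] using (hp₂.map g).mul ((hp₁.map g).mul hb)
    · rw [RingHom.comp_apply, RingHom.comp_apply, ← e₂, map_mul, ← e₁]
      simp only [map_mul, ← e, mul_assoc]
  · obtain ⟨b, hb, e⟩ := hg.exists_mul_eq_zero (f r) hr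
    obtain ⟨p, r', hp, e'⟩ := hf.exists_mul_eq b
    obtain ⟨q, hq, e''⟩ := hf.exists_mul_eq_zero (r' * r)
      (by rw [map_mul, ← e', mul_assoc, e, mul_zero])
    refine ⟨q * r', ?_, by rw [mul_assoc, e'']⟩
    rw [RingHom.comp_apply, map_mul, ← e']
    simpa only [map_mul] using (hq.map g).mul ((hp.map g).mul hb)

variable {f : R →+* B} (hf : IsLeftLocalizationMap f)
include hf

theorem mem_ass {r : R} : r ∈ ass (unitPreimage f) ↔ f r = 0 := by
  refine ⟨fun ⟨s, hs, e⟩ => ?_, fun h => hf.exists_mul_eq_zero r h⟩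
  have : f s * f r = 0 := by rw [← map_mul, e, map_zero]
  exact (mem_unitPreimage.1 hs).mul_right_eq_zero.1 this

theorem isLeftDenominatorSet [Nontrivial B] : IsLeftDenominatorSet (unitPreimage f) := by
  refine ⟨⟨fun h => ?_, fun r s hs => ?_⟩, fun r s hs h => hf.mem_ass.2 ?_⟩
  · rw [mem_unitPreimage, map_zero] at h
    exact not_isUnit_zero h
  · obtain ⟨u, hu⟩ := mem_unitPreimage.1 hs
    -- Rewriting the right fraction `f(r) f(s)⁻¹` as a left fraction `f(p)⁻¹ f(r')` gives the Ore
    -- condition up to the kernel; `q` removes the error.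
    obtain ⟨p, r', hp, e⟩ := hf.exists_mul_eq (f r * (u⁻¹ : Bˣ))
    obtain ⟨q, hq, e'⟩ := hf.exists_mul_eq_zero (p * r - r' * s) (by
      rw [map_sub, map_mul, map_mul, ← e, ← hu, mul_assoc, Units.inv_mul_cancel_right, sub_self])
    refine ⟨q * p, mem_unitPreimage.2 (by rw [map_mul]; exact hq.mul hp), q * r', ?_⟩
    rw [mul_sub, sub_eq_zero] at e'
    rw [mul_assoc, e', mul_assoc]
  · have : f r * f s = 0 := by rw [← map_mul, h, map_zero]
    exact (mem_unitPreimage.1 hs).mul_left_eq_zero.1 this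

end IsLeftLocalizationMap

theorem isLeftLocalizationMap_evalRingHom {ι : Type*} {A : ι → Type*} [∀ i, Ring (A i)] (i : ι) :
    IsLeftLocalizationMap (Pi.evalRingHom A i) := by
  classical
  refine ⟨fun b => ⟨1, Pi.single i b, by simp, by simp⟩,
    fun r hr => ⟨Pi.single i 1, by simp, ?_⟩⟩
  ext j
  obtain rfl | hj := eq_or_ne j i
  · simpa using hr
  · simp [hj]

theorem isLeftLocalizationMap_ringEquiv (e : B ≃+* C) :
    IsLeftLocalizationMap (e : B →+* C) :=
  ⟨fun c => ⟨1, e.symm c, by simp, by simp⟩, fun r hr => ⟨1, by simp, by simpa using hr⟩⟩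

/-- The target of a left localization map is the Ore localization at the elements it inverts. -/
theorem IsLeftLocalizationMap.nonempty_ringEquiv {f : R →+* B} (hf : IsLeftLocalizationMap f)
    [OreLocalization.OreSet (unitPreimage f)] :
    Nonempty (OreLocalization (unitPreimage f) R ≃+* B) := by
  let fS : unitPreimage f →* Bˣ :=
    IsUnit.liftRight ((f : R →* B).comp (unitPreimage f).subtype) fun s => s.2
  have hfS (s : unitPreimage f) : f s = fS s := rfl
  refine ⟨RingEquiv.ofBijective (OreLocalization.universalHom f fS hfS) ⟨?_, fun b => ?_⟩⟩
  · refine (injective_iff_map_eq_zero _).2 fun x hx => ?_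
    induction x with | _ r s
    rw [OreLocalization.universalHom_apply, Units.mul_right_eq_zero] at hx
    obtain ⟨p, hp, e⟩ := hf.exists_mul_eq_zero r hx
    rw [OreLocalization.expand r s (p : R) (((unitPreimage f).mul_mem hp s.2))]
    simp only [smul_eq_mul, e, OreLocalization.zero_oreDiv]
  · obtain ⟨p, r, hp, e⟩ := hf.exists_mul_eq b
    refine ⟨OreLocalization.oreDiv r ⟨p, hp⟩, ?_⟩
    rw [OreLocalization.universalHom_apply, ← e]
    exact (fS ⟨p, hp⟩).inv_mul_cancel_left b

end LocalizationMap

/-! ### Ore localizations as left localization maps -/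

section OreLocalization

variable {R : Type*} [Ring R] (S : Submonoid R) [OreLocalization.OreSet S]

theorem isUnit_numeratorRingHom {s : R} (hs : s ∈ S) :
    IsUnit (OreLocalization.numeratorRingHom (S := S) s) :=
  OreLocalization.numerator_isUnit ⟨s, hs⟩

theorem numeratorRingHom_eq_zero_iff {r : R} :
    OreLocalization.numeratorRingHom (S := S) r = 0 ↔ r ∈ ass S := by
  change OreLocalization.oreDiv r (1 : S) = 0 ↔ _
  rw [OreLocalization.zero_def, OreLocalization.oreDiv_eq_iff]
  constructor
  · rintro ⟨u, v, h, h'⟩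
    have h'' : (u : R) = v := by simpa using h'
    exact ⟨u, u.2, by rw [h'']; simpa using h.symm⟩
  · rintro ⟨s, hs, e⟩
    exact ⟨⟨s, hs⟩, s, by simp [e], by simp⟩

theorem isLeftLocalizationMap_numeratorRingHom :
    IsLeftLocalizationMap (OreLocalization.numeratorRingHom (R := R) (S := S)) := by
  refine ⟨fun b => ?_, fun r hr => ?_⟩
  · induction b with | _ r s
    refine ⟨s, r, isUnit_numeratorRingHom S s.2, ?_⟩
    exact OreLocalization.mul_cancel (s := s) (t := 1)
  · obtain ⟨s, hs, e⟩ := (numeratorRingHom_eq_zero_iff S).1 hr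
    exact ⟨s, isUnit_numeratorRingHom S hs, e⟩

end OreLocalization

/-! ### Maximal left denominator sets -/

section LeftLocalization

variable {R : Type u} [Ring R] {S : Submonoid R} (h : IsLeftDenominatorSet S)

/-- The canonical homomorphism `R → S⁻¹R`. -/
noncomputable def toLeftLocalization : R →+* LeftLocalization S h :=
  letI := h.oreSet
  OreLocalization.numeratorRingHom (S := S)

theorem isLeftLocalizationMap_toLeftLocalization :
    IsLeftLocalizationMap (toLeftLocalization h) :=
  letI := h.oreSet
  isLeftLocalizationMap_numeratorRingHom S

theorem toLeftLocalization_eq_zero_iff {r : R} : toLeftLocalization h r = 0 ↔ r ∈ ass S :=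
  letI := h.oreSet
  numeratorRingHom_eq_zero_iff S

theorem le_unitPreimage_toLeftLocalization : S ≤ unitPreimage (toLeftLocalization h) :=
  letI := h.oreSet
  fun _ hs => isUnit_numeratorRingHom S hs

include h in
theorem IsLeftDenominatorSet.notMem_ass {r : R} (hr : r ∈ S) : r ∉ ass S :=
  fun ⟨_, hs, e⟩ => h.zero_notMem (e ▸ S.mul_mem hs hr)

theorem nontrivial_leftLocalization : Nontrivial (LeftLocalization S h) := by
  refine ⟨1, 0, fun e => h.notMem_ass S.one_mem ?_⟩
  rw [← toLeftLocalization_eq_zero_iff h, map_one, e]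

include h in
-- Zorn's lemma: each axiom involves one denominator at a time, so it passes to the union of a
-- nonempty chain.
theorem IsLeftDenominatorSet.exists_le_maxDen : ∃ T ∈ maxDen R, S ≤ T := by
  suffices hub : ∀ c ⊆ {S : Submonoid R | IsLeftDenominatorSet S}, IsChain (· ≤ ·) c →
      ∀ y ∈ c, ∃ U ∈ {S : Submonoid R | IsLeftDenominatorSet S}, ∀ z ∈ c, z ≤ U by
    obtain ⟨T, hST, hT⟩ := zorn_le_nonempty₀ _ hub S h
    exact ⟨T, hT, hST⟩
  intro c hc hchain y hy
  have hmem {x : R} : x ∈ sSup c ↔ ∃ s ∈ c, x ∈ s :=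
    Submonoid.mem_sSup_of_directedOn ⟨y, hy⟩ hchain.directedOn
  refine ⟨sSup c, ⟨⟨fun h0 => ?_, fun r s hs => ?_⟩, fun r s hs e => ?_⟩, fun z hz => le_sSup hz⟩
  · obtain ⟨s, hs, h0⟩ := hmem.1 h0
    exact (hc hs).zero_notMem h0
  · obtain ⟨U, hU, hs⟩ := hmem.1 hs
    obtain ⟨s', hs', r', e⟩ := (hc hU).ore r s hs
    exact ⟨s', hmem.2 ⟨U, hU, hs'⟩, r', e⟩
  · obtain ⟨U, hU, hs⟩ := hmem.1 hs
    obtain ⟨t, ht, e'⟩ := (hc hU).reversible r s hs e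
    exact ⟨t, hmem.2 ⟨U, hU, ht⟩, e'⟩

theorem mem_localizable_iff {r : R} : r ∈ localizable R ↔ ∃ S ∈ maxDen R, r ∈ S := by
  constructor
  · rintro ⟨S, hS, hr⟩
    obtain ⟨T, hT, hST⟩ := hS.exists_le_maxDen
    exact ⟨T, hT, hST hr⟩
  · rintro ⟨S, hS, hr⟩
    exact ⟨S, hS.prop, hr⟩

theorem eq_unitPreimage_of_le {B : Type*} [Ring B] [Nontrivial B] {f : R →+* B}
    (hf : IsLeftLocalizationMap f) (hS : S ∈ maxDen R) (hle : S ≤ unitPreimage f) :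
    S = unitPreimage f :=
  hS.eq_of_le hf.isLeftDenominatorSet hle

theorem unitPreimage_toLeftLocalization (hS : S ∈ maxDen R) :
    S = unitPreimage (toLeftLocalization hS.prop) :=
  haveI := nontrivial_leftLocalization hS.prop
  eq_unitPreimage_of_le (isLeftLocalizationMap_toLeftLocalization _) hS
    (le_unitPreimage_toLeftLocalization _)

/-- In the localization at a maximal left denominator set, left localizable elements are units. -/
theorem isUnit_of_mem_localizable (hS : S ∈ maxDen R) {a : LeftLocalization S hS.prop}
    (ha : a ∈ localizable (LeftLocalization S hS.prop)) : IsUnit a := by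
  obtain ⟨T, hT, haT⟩ := ha
  have hσ := isLeftLocalizationMap_toLeftLocalization hS.prop
  have := nontrivial_leftLocalization hT
  -- The composite `R → S⁻¹R → T⁻¹(S⁻¹R)` is a localization map inverting `S`, so by maximality it
  -- inverts nothing more.
  have hS' : S = unitPreimage ((toLeftLocalization hT).comp (toLeftLocalization hS.prop)) :=
    eq_unitPreimage_of_le ((isLeftLocalizationMap_toLeftLocalization hT).comp hσ) hS
      fun s hs => (le_unitPreimage_toLeftLocalization hS.prop hs).map (toLeftLocalization hT)
  obtain ⟨p, r, hp, e⟩ := hσ.exists_mul_eq a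
  have hr : r ∈ S := by
    rw [hS', mem_unitPreimage, RingHom.comp_apply, ← e, map_mul]
    exact (hp.map _).mul (le_unitPreimage_toLeftLocalization hT haT)
  have hr' := le_unitPreimage_toLeftLocalization hS.prop hr
  rw [mem_unitPreimage, ← e] at hr'
  exact (hp.unit.isUnit_units_mul a).1 hr'

end LeftLocalization

/-! ### Local rings with nil Jacobson radical -/

section NilOrUnit

variable (A : Type*) [Ring A]

/-- A nonzero ring all of whose elements are nilpotent or invertible. -/
structure IsNilOrUnitRing : Prop extends Nontrivial A where
  isNilpotent_or_isUnit : ∀ a : A, IsNilpotent a ∨ IsUnit a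

variable {A}

theorem IsNilOrUnitRing.of_ringEquiv {B : Type*} [Ring B] (h : IsNilOrUnitRing A) (e : A ≃+* B) :
    IsNilOrUnitRing B where
  toNontrivial := haveI := h.toNontrivial; e.injective.nontrivial
  isNilpotent_or_isUnit b := by
    rcases h.isNilpotent_or_isUnit (e.symm b) with hb | hb
    · exact .inl (by simpa using hb.map e)
    · exact .inr (by simpa using hb.map e)

theorem IsNilOrUnitRing.isWeaklyLeftLocalizable {A : Type u} [Ring A] (h : IsNilOrUnitRing A) :
    IsWeaklyLeftLocalizable A := by
  intro a ha
  have := h.toNontrivial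
  exact ⟨_, (isLeftLocalizationMap_ringEquiv (RingEquiv.refl A)).isLeftDenominatorSet,
    (h.isNilpotent_or_isUnit a).resolve_left ha⟩

theorem IsNilOrUnitRing.isLocalRing (h : IsNilOrUnitRing A) : IsLocalRing A where
  toNontrivial := h.toNontrivial
  isUnit_or_isUnit_of_add_one {a b} e := by
    refine (h.isNilpotent_or_isUnit a).elim (fun ha => .inr ?_) .inl
    rw [eq_sub_of_add_eq' e]
    exact ha.isUnit_one_sub

theorem isNilpotent_of_mem_nilRad {A : Type u} [Ring A] {x : A} (hx : x ∈ nilRad A) :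
    IsNilpotent x := by
  rw [nilRad, Submodule.mem_sSup_of_directed] at hx
  · obtain ⟨I, hI, hx⟩ := hx
    exact hI.2 x hx
  · exact ⟨⊥, inferInstance, fun x hx => by rw [Ideal.mem_bot.1 hx]; exact .zero⟩
  · rintro I ⟨hI, hI'⟩ J ⟨hJ, hJ'⟩
    refine ⟨I ⊔ J, ⟨⟨fun b hz => ?_⟩, fun z hz => ?_⟩, le_sup_left, le_sup_right⟩
    · obtain ⟨x, hx, y, hy, rfl⟩ := Submodule.mem_sup.1 hz
      rw [add_mul]
      exact Submodule.add_mem_sup (Ideal.mul_mem_right b I hx) (Ideal.mul_mem_right b J hy)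
    obtain ⟨x, hx, y, hy, rfl⟩ := Submodule.mem_sup.1 hz
    obtain ⟨k, hk⟩ := hI' x hx
    -- Modulo `J` the element `x + y` equals `x`, so its `k`-th power lies in the nil ideal `J`.
    obtain ⟨l, hl⟩ := hJ' ((x + y) ^ k) (by
      rw [← Ideal.Quotient.eq_zero_iff_mem, map_pow, map_add,
        Ideal.Quotient.eq_zero_iff_mem.2 hy, add_zero, ← map_pow, hk, map_zero])
    exact ⟨k * l, by rw [pow_mul, hl]⟩

theorem IsNilOrUnitRing.jacobson_eq_nilRad {A : Type u} [Ring A] (h : IsNilOrUnitRing A) :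
    Ring.jacobson A = nilRad A := by
  have := h.toNontrivial
  refine le_antisymm (le_sSup ⟨inferInstance, fun x hx => ?_⟩) (sSup_le fun I hI x hx => ?_)
  · refine (h.isNilpotent_or_isUnit x).resolve_right fun hu => ?_
    exact (Ring.jacobson_lt_top A).ne (Ideal.eq_top_of_isUnit_mem _ hx hu)
  · rw [← Ideal.jacobson_bot, Ideal.mem_jacobson_iff]
    intro y
    obtain ⟨u, hu⟩ := (hI.2 (y * x) (I.mul_mem_left y hx)).isUnit_add_one
    refine ⟨(u⁻¹ : Aˣ), Ideal.mem_bot.2 ?_⟩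
    rw [mul_assoc, sub_eq_zero, ← mul_add_one, ← hu, Units.inv_mul]

/-- The product `a * y` is idempotent, and a local ring has no idempotents besides `0` and `1`. -/
theorem isUnit_of_mul_eq_one_of_isLocalRing [IsLocalRing A] {a y : A} (h : y * a = 1) :
    IsUnit a := by
  have hi : (a * y) * (a * y) = a * y := by rw [mul_assoc, ← mul_assoc y, h, one_mul]
  rcases IsLocalRing.isUnit_or_isUnit_of_add_one (add_sub_cancel (a * y) 1) with hu | hu
  · exact ⟨⟨a, y, hu.mul_left_cancel (by rw [hi, mul_one]), h⟩, rfl⟩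
  · have h0 : a * y = 0 := hu.mul_right_eq_zero.1 (by rw [sub_mul, one_mul, hi, sub_self])
    refine absurd ?_ (one_ne_zero (α := A))
    calc (1 : A) = y * (a * y) * a := by rw [← mul_assoc, h, one_mul, h]
      _ = 0 := by rw [h0, mul_zero, zero_mul]

theorem IsNilOrUnitRing.of_jacobson_eq_nilRad {A : Type u} [Ring A] [IsLocalRing A]
    (h : Ring.jacobson A = nilRad A) : IsNilOrUnitRing A where
  isNilpotent_or_isUnit a := by
    refine or_iff_not_imp_right.2 fun ha => isNilpotent_of_mem_nilRad ?_
    rw [← h, ← Ideal.jacobson_bot, Ideal.mem_jacobson_iff]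
    intro y
    -- If `y * a` were a unit, `a` would be left invertible, hence a unit; so `y * a + 1` is a unit
    -- for every `y`, which puts `a` in the radical.
    rcases IsLocalRing.isUnit_or_isUnit_of_add_one
      (show -(y * a) + (y * a + 1) = 1 by abel) with hu | ⟨u, hu⟩
    · obtain ⟨u, hu⟩ := IsUnit.neg_iff _ |>.1 hu
      refine absurd (isUnit_of_mul_eq_one_of_isLocalRing (y := (u⁻¹ : Aˣ) * y) ?_) ha
      rw [mul_assoc, ← hu, Units.inv_mul]
    · refine ⟨(u⁻¹ : Aˣ), Ideal.mem_bot.2 ?_⟩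
      rw [mul_assoc, sub_eq_zero, ← mul_add_one, ← hu, Units.inv_mul]

theorem isFiniteProdOfNilLocal_iff {Q : Type u} [Ring Q] :
    IsFiniteProdOfNilLocal Q ↔ ∃ (n : ℕ) (A : Fin n → Type u) (_ : ∀ i, Ring (A i)),
      (∀ i, IsNilOrUnitRing (A i)) ∧ Nonempty (Q ≃+* ∀ i, A i) := by
  constructor
  · rintro ⟨n, A, _, hA, e⟩
    exact ⟨n, A, _, fun i => haveI := (hA i).1; .of_jacobson_eq_nilRad (hA i).2, e⟩
  · rintro ⟨n, A, _, hA, e⟩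
    exact ⟨n, A, _, fun i => ⟨(hA i).isLocalRing, (hA i).jacobson_eq_nilRad⟩, e⟩

end NilOrUnit

/-! ### Passing between `R` and `R/𝔩` -/

section Quotient

variable {R : Type u} [Ring R]

local notation "π" => Ideal.Quotient.mk (locRadical R)

/-- `{1}` is a denominator set, so `maxDen R` is nonempty and `𝔩` is not an empty intersection. -/
theorem nontrivial_quotient_locRadical [Nontrivial R] : Nontrivial (R ⧸ locRadical R) := by
  have h1 : IsLeftDenominatorSet (⊥ : Submonoid R) := by
    refine ⟨⟨fun h => zero_ne_one (Submonoid.mem_bot.1 h), fun r s hs => ?_⟩, fun r s hs h => ?_⟩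
    · exact ⟨1, Submonoid.one_mem _, r, by rw [Submonoid.mem_bot.1 hs]; simp⟩
    · rw [Submonoid.mem_bot.1 hs, mul_one] at h
      exact h ▸ zero_mem_ass _
  obtain ⟨T, hT, -⟩ := h1.exists_le_maxDen
  refine Ideal.Quotient.nontrivial_iff.2 fun h => hT.prop.notMem_ass T.one_mem ?_
  exact mem_locRadical.1 (h ▸ Submodule.mem_top) T hT

/-- Membership in `S` depends only on the image in `S⁻¹R`, hence only on the class modulo `𝔩 ⊆ ass
S`. -/
theorem comap_map_mk {S : Submonoid R} (hS : S ∈ maxDen R) : (S.map π).comap π = S := by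
  refine le_antisymm ?_ (Submonoid.le_comap_map S)
  rintro r ⟨s, hs, e⟩
  have h : r - s ∈ ass S := mem_locRadical.1
    (Ideal.Quotient.eq_zero_iff_mem.1 (by rw [map_sub, sub_eq_zero]; exact e.symm)) S hS
  rw [← toLeftLocalization_eq_zero_iff hS.prop, map_sub, sub_eq_zero] at h
  rw [unitPreimage_toLeftLocalization hS, mem_unitPreimage, h]
  exact le_unitPreimage_toLeftLocalization hS.prop hs

theorem maxDenMap_injective : Function.Injective (maxDenMap R) := by
  intro S T h
  have h' : (S : Submonoid R).map π = (T : Submonoid R).map π := congrArg Subtype.val h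
  exact Subtype.ext (by rw [← comap_map_mk S.2, h', comap_map_mk T.2])

theorem image_localizable_subset : π '' localizable R ⊆ localizable (R ⧸ locRadical R) := by
  rintro _ ⟨r, hr, rfl⟩
  obtain ⟨S, hS, hr⟩ := mem_localizable_iff.1 hr
  exact mem_localizable_iff.2 ⟨_, map_mem_maxDen R hS, r, hr, rfl⟩

theorem image_localizable_eq (h : Function.Surjective (maxDenMap R)) :
    π '' localizable R = localizable (R ⧸ locRadical R) := by
  refine image_localizable_subset.antisymm fun r hr => ?_
  obtain ⟨S', hS', hr⟩ := mem_localizable_iff.1 hr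
  obtain ⟨S, hS⟩ := h ⟨S', hS'⟩
  obtain rfl : (S : Submonoid R).map π = S' := congrArg Subtype.val hS
  obtain ⟨s, hs, rfl⟩ := hr
  exact ⟨s, mem_localizable_iff.2 ⟨S, S.2, hs⟩, rfl⟩

/-- A localization map of `R/𝔩` with inverted set `π'(S)` pulls back to one of `R`. -/
theorem IsLeftLocalizationMap.comp_mk {B : Type*} [Ring B] {f : R ⧸ locRadical R →+* B}
    (hf : IsLeftLocalizationMap f) {S : Submonoid R} (hS : S ∈ maxDen R)
    (hSf : S.map π = unitPreimage f) : IsLeftLocalizationMap (f.comp π) := by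
  refine ⟨fun b => ?_, fun r hr => ?_⟩
  · obtain ⟨p, r, hp, e⟩ := hf.exists_mul_eq b
    obtain ⟨p, rfl⟩ := Ideal.Quotient.mk_surjective p
    obtain ⟨r, rfl⟩ := Ideal.Quotient.mk_surjective r
    exact ⟨p, r, hp, e⟩
  · have hunit {s : R} (hs : s ∈ S) : IsUnit (f (π s)) :=
      mem_unitPreimage.1 (hSf ▸ Submonoid.mem_map_of_mem _ hs)
    obtain ⟨p, hp, e⟩ := hf.exists_mul_eq_zero (π r) hr
    obtain ⟨s, hs, rfl⟩ : p ∈ S.map π := hSf ▸ hp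
    have hsr : s * r ∈ locRadical R :=
      Ideal.Quotient.eq_zero_iff_mem.1 (by rw [map_mul]; exact e)
    obtain ⟨t, ht, e'⟩ := mem_locRadical.1 hsr S hS
    exact ⟨t * s, hunit (S.mul_mem ht hs), by rw [mul_assoc, e']⟩

theorem IsLeftLocalizationMap.unitPreimage_comp_mk {B : Type*} [Ring B]
    {f : R ⧸ locRadical R →+* B} {S : Submonoid R} (hS : S ∈ maxDen R)
    (hSf : S.map π = unitPreimage f) : unitPreimage (f.comp π) = S := by
  rw [← comap_map_mk hS, hSf]
  rfl

end Quotient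

/-! ### Left orders in products of nil-or-unit rings -/

section Product

variable {R : Type u} [Ring R] {ι : Type*} {A : ι → Type*} [∀ i, Ring (A i)]
  {f : R →+* ∀ i, A i}

/-- The `i`-th component of a homomorphism to a product. -/
def component (f : R →+* ∀ i, A i) (i : ι) : R →+* A i := (Pi.evalRingHom A i).comp f

theorem component_apply (i : ι) (r : R) : component f i r = f r i := rfl

variable (hf : IsLeftLocalizationMap f)
include hf

theorem IsLeftLocalizationMap.component (i : ι) : IsLeftLocalizationMap (component f i) :=
  (isLeftLocalizationMap_evalRingHom i).comp hf

theorem IsLeftLocalizationMap.exists_component (i : ι) :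
    ∃ r, IsUnit (f r i) ∧ ∀ j ≠ i, f r j = 0 := by
  classical
  obtain ⟨p, r, hp, e⟩ := hf.exists_mul_eq (Pi.single i 1)
  refine ⟨r, ?_, fun j hj => ?_⟩
  · rw [← e, Pi.mul_apply, Pi.single_eq_same, mul_one]
    exact hp.map (Pi.evalRingHom A i)
  · rw [← e, Pi.mul_apply, Pi.single_eq_of_ne hj, mul_zero]

variable (hinj : Function.Injective f) (hA : ∀ i, IsNilOrUnitRing (A i))
include hinj hA

omit hinj in
theorem unitPreimage_component_mem_maxDen (i : ι) :
    unitPreimage (LeftLoc.component f i) ∈ maxDen R := by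
  have := (hA i).toNontrivial
  refine ⟨(hf.component i).isLeftDenominatorSet, fun T hT hle t ht => ?_⟩
  -- If `t` had nilpotent image, some power of it would be killed by an element of `T`, forcing `0 ∈
  -- T`.
  refine ((hA i).isNilpotent_or_isUnit _).resolve_left fun ⟨k, hk⟩ => ?_
  obtain ⟨p, hp, e⟩ := (hf.component i).exists_mul_eq_zero (t ^ k) (by rw [map_pow, hk])
  exact hT.zero_notMem (e ▸ T.mul_mem (hle hp) (T.pow_mem ht k))

omit hf in
-- Otherwise for each `i` some element of `T` vanishes in component `i`; the product of these is `0
-- ∈ T`.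
theorem IsLeftDenominatorSet.exists_le_unitPreimage_component [Finite ι] {T : Submonoid R}
    (hT : IsLeftDenominatorSet T) : ∃ i, T ≤ unitPreimage (LeftLoc.component f i) := by
  classical
  have := Fintype.ofFinite ι
  by_contra! h
  have h' (i : ι) : ∃ t ∈ T, f t i = 0 := by
    obtain ⟨t, ht, ht'⟩ := SetLike.not_le_iff_exists.1 (h i)
    obtain ⟨k, hk⟩ := ((hA i).isNilpotent_or_isUnit (f t i)).resolve_right ht'
    exact ⟨t ^ k, T.pow_mem ht k, by rw [map_pow, Pi.pow_apply, hk]⟩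
  have key (s : Finset ι) : ∃ t ∈ T, ∀ i ∈ s, f t i = 0 := by
    induction s using Finset.induction_on with
    | empty => exact ⟨1, T.one_mem, by simp⟩
    | insert a s _ ih =>
      obtain ⟨t, ht, h0⟩ := ih
      obtain ⟨t', ht', h0'⟩ := h' a
      refine ⟨t * t', T.mul_mem ht ht', fun i hi => ?_⟩
      rw [map_mul, Pi.mul_apply]
      rcases Finset.mem_insert.1 hi with rfl | hi
      · rw [h0', mul_zero]
      · rw [h0 i hi, zero_mul]
  obtain ⟨t, ht, h0⟩ := key Finset.univ
  have : t = 0 := hinj (by rw [map_zero]; exact funext fun i => h0 i (Finset.mem_univ i))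
  exact hT.zero_notMem (this ▸ ht)

theorem mem_maxDen_iff_of_injective [Finite ι] {T : Submonoid R} :
    T ∈ maxDen R ↔ ∃ i, T = unitPreimage (LeftLoc.component f i) := by
  refine ⟨fun hT => ?_, ?_⟩
  · obtain ⟨i, hi⟩ := hT.prop.exists_le_unitPreimage_component hinj hA
    exact ⟨i, hT.eq_of_le (unitPreimage_component_mem_maxDen hf hA i).prop hi⟩
  · rintro ⟨i, rfl⟩
    exact unitPreimage_component_mem_maxDen hf hA i

omit hf in
theorem exists_isUnit_component [Finite ι] {r : R} (hr : ¬ IsNilpotent r) :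
    ∃ i, IsUnit (f r i) := by
  have := Fintype.ofFinite ι
  by_contra! h
  have h' (i : ι) : ∃ k, f r i ^ k = 0 := ((hA i).isNilpotent_or_isUnit _).resolve_right (h i)
  choose k hk using h'
  refine hr ⟨∑ i, k i, hinj (funext fun i => ?_)⟩
  rw [map_pow, Pi.pow_apply, map_zero, Pi.zero_apply]
  exact pow_eq_zero_of_le (Finset.single_le_sum (fun _ _ => Nat.zero_le _) (Finset.mem_univ i))
    (hk i)

theorem unitPreimage_eq_nonZeroDivisors : unitPreimage f = nonZeroDivisors R := by
  refine le_antisymm (fun r hr => ?_) fun c hc => ?_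
  · refine mem_nonZeroDivisors_iff.2 ⟨fun x hx => ?_, fun x hx => ?_⟩
    · have : f r * f x = 0 := by rw [← map_mul, hx, map_zero]
      exact (map_eq_zero_iff f hinj).1 ((mem_unitPreimage.1 hr).mul_right_eq_zero.1 this)
    · have : f x * f r = 0 := by rw [← map_mul, hx, map_zero]
      exact (map_eq_zero_iff f hinj).1 ((mem_unitPreimage.1 hr).mul_left_eq_zero.1 this)
  · refine mem_unitPreimage.2 (Pi.isUnit_iff.2 fun i => ?_)
    refine ((hA i).isNilpotent_or_isUnit _).resolve_left fun ⟨k, hk⟩ => ?_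
    have := (hA i).toNontrivial
    obtain ⟨r, hr, h0⟩ := hf.exists_component i
    -- Since `r` is supported on component `i`, where `c ^ k` vanishes, regularity of `c` would give
    -- `r = 0`.
    have hcr : c ^ k * r = 0 := hinj <| funext fun j => by
      rw [map_mul, map_pow, map_zero, Pi.mul_apply, Pi.pow_apply, Pi.zero_apply]
      obtain rfl | hj := eq_or_ne j i
      · rw [hk, zero_mul]
      · rw [h0 j hj, mul_zero]
    have hr0 := (mem_nonZeroDivisors_iff.1 (pow_mem hc k)).1 r hcr
    rw [hr0, map_zero] at hr
    exact not_isUnit_zero hr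

end Product

/-- `R` embeds as a left order into a finite product of rings whose elements are nilpotent or
invertible. -/
def IsLeftOrderInProd (R : Type u) [Ring R] : Prop :=
  ∃ (n : ℕ) (A : Fin n → Type u) (_ : ∀ i, Ring (A i)), (∀ i, IsNilOrUnitRing (A i)) ∧
    ∃ f : R →+* ∀ i, A i, Function.Injective f ∧ IsLeftLocalizationMap f

/-! ### Left orders and the two quotient rings -/

section Order

variable {R : Type u} [Ring R]

theorem ass_eq_zero_of_le_nonZeroDivisors {S : Submonoid R} (h : S ≤ nonZeroDivisors R) :
    ass S = {0} := by
  refine Set.Subset.antisymm ?_ (by rintro _ rfl; exact zero_mem_ass _)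
  rintro r ⟨s, hs, e⟩
  exact (mem_nonZeroDivisors_iff.1 (h hs)).1 r e

theorem isLeftOrderInProd_of_oreLocalization {S : Submonoid R} [OreLocalization.OreSet S]
    (h : S ≤ nonZeroDivisors R) (hQ : IsFiniteProdOfNilLocal (OreLocalization S R)) :
    IsLeftOrderInProd R := by
  obtain ⟨n, A, _, hA, ⟨e⟩⟩ := isFiniteProdOfNilLocal_iff.1 hQ
  refine ⟨n, A, _, hA, (e : _ →+* _).comp (OreLocalization.numeratorRingHom (S := S)),
    e.injective.comp ((injective_iff_map_eq_zero _).2 fun r hr => ?_),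
    (isLeftLocalizationMap_ringEquiv e).comp (isLeftLocalizationMap_numeratorRingHom S)⟩
  rw [numeratorRingHom_eq_zero_iff, ass_eq_zero_of_le_nonZeroDivisors h] at hr
  exact hr

theorem IsLeftOrderInProd.isLeftDenominatorSet [Nontrivial R] (h : IsLeftOrderInProd R) :
    IsLeftDenominatorSet (nonZeroDivisors R) := by
  obtain ⟨n, A, _, hA, f, hinj, hf⟩ := h
  have := hinj.nontrivial
  rw [← unitPreimage_eq_nonZeroDivisors hf hinj hA]
  exact hf.isLeftDenominatorSet

theorem IsLeftOrderInProd.isFiniteProdOfNilLocal (h : IsLeftOrderInProd R) {S : Submonoid R}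
    (hS : S = nonZeroDivisors R) [OreLocalization.OreSet S] :
    IsFiniteProdOfNilLocal (OreLocalization S R) := by
  obtain ⟨n, A, _, hA, f, hinj, hf⟩ := h
  obtain rfl : unitPreimage f = S := by rw [hS, unitPreimage_eq_nonZeroDivisors hf hinj hA]
  exact isFiniteProdOfNilLocal_iff.2 ⟨n, A, _, hA, hf.nonempty_ringEquiv⟩

theorem isLeftOrderInProd_iff_classical [Nontrivial R] : IsLeftOrderInProd R ↔
    ∃ h : IsLeftDenominatorSet (nonZeroDivisors R),
      IsFiniteProdOfNilLocal (LeftLocalization (nonZeroDivisors R) h) := by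
  refine ⟨fun h => ⟨h.isLeftDenominatorSet, ?_⟩, fun ⟨h, hQ⟩ => ?_⟩
  · let := h.isLeftDenominatorSet.oreSet
    exact h.isFiniteProdOfNilLocal rfl
  · let := h.oreSet
    exact isLeftOrderInProd_of_oreLocalization le_rfl hQ

theorem isLeftOrderInProd_iff_largest [Nontrivial R] : IsLeftOrderInProd R ↔
    IsFiniteProdOfNilLocal (LargestLeftQuotientRing R) := by
  let := largestRegularDenOreSet R
  refine ⟨fun h => ?_, isLeftOrderInProd_of_oreLocalization (largestRegularDen_le R)⟩
  -- All regular elements form a denominator set with zero `ass`, so `S_{l,0}` is the whole of them.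
  refine h.isFiniteProdOfNilLocal (le_antisymm (largestRegularDen_le R) (le_sSup ?_))
  exact ⟨h.isLeftDenominatorSet, ass_eq_zero_of_le_nonZeroDivisors le_rfl⟩

end Order

/-! ### The two implications -/

section Main

variable {R : Type u} [Ring R]

theorem isNilpotent_of_mem_locRadical (h : IsWeaklyLeftLocalizable R) {x : R}
    (hx : x ∈ locRadical R) : IsNilpotent x := by
  by_contra hn
  obtain ⟨S, hS, hxS⟩ := mem_localizable_iff.1 (h x hn)
  exact hS.prop.notMem_ass hxS (mem_locRadical.1 hx S hS)

theorem isNilOrUnitRing_leftLocalization {S : Submonoid R} (hS : S ∈ maxDen R)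
    (h : IsWeaklyLeftLocalizable (LeftLocalization S hS.prop)) :
    IsNilOrUnitRing (LeftLocalization S hS.prop) where
  toNontrivial := nontrivial_leftLocalization hS.prop
  isNilpotent_or_isUnit a :=
    or_iff_not_imp_left.2 fun ha => isUnit_of_mem_localizable hS (h a ha)

/-- Multiply the pairwise separators: each `ass (S i)` is a two-sided ideal, and `S j` is closed
under products. -/
theorem exists_mem_forall_mem_ass {ι : Type*} [Finite ι] {S : ι → Submonoid R}
    (hS : ∀ i, IsLeftDenominatorSet (S i)) (h : ∀ i j, i ≠ j → ∃ a ∈ ass (S i), a ∈ S j) (j : ι) :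
    ∃ c ∈ S j, ∀ i ≠ j, c ∈ ass (S i) := by
  classical
  have := Fintype.ofFinite ι
  have key (s : Finset ι) : ∃ c ∈ S j, ∀ i ∈ s, i ≠ j → c ∈ ass (S i) := by
    induction s using Finset.induction_on with
    | empty => exact ⟨1, (S j).one_mem, by simp⟩
    | insert a s _ ih =>
      obtain ⟨c, hc, hcs⟩ := ih
      obtain rfl | ha := eq_or_ne a j
      · refine ⟨c, hc, fun i hi hij => hcs i ((Finset.mem_insert.1 hi).resolve_left hij) hij⟩
      obtain ⟨b, hb, hbj⟩ := h a j ha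
      refine ⟨c * b, (S j).mul_mem hc hbj, fun i hi hij => ?_⟩
      rcases Finset.mem_insert.1 hi with rfl | hi
      · exact (hS i).mul_mem_ass c hb
      · exact mul_mem_ass_right (hcs i hi hij) b
  obtain ⟨c, hc, hcs⟩ := key Finset.univ
  exact ⟨c, hc, fun i => hcs i (Finset.mem_univ i)⟩

theorem isLeftLocalizationMap_pi {ι : Type*} [Finite ι] {R' : Type*} [Ring R'] {A : ι → Type*}
    [∀ i, Ring (A i)] {f : R' →+* ∀ i, A i} (hinj : Function.Injective f)
    (hf : ∀ i, IsLeftLocalizationMap (component f i))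
    (hc : ∀ j, ∃ c, IsUnit (f c j) ∧ ∀ i ≠ j, f c i = 0) : IsLeftLocalizationMap f := by
  classical
  have := Fintype.ofFinite ι
  refine ⟨fun b => ?_, fun r hr => ⟨1, by simp, by rw [one_mul, hinj (hr.trans f.map_zero.symm)]⟩⟩
  choose c hcu hc0 using hc
  choose p r hp e using fun i => (hf i).exists_mul_eq (b i)
  simp only [component_apply] at hp e
  have hsum (x : ι → R') (i : ι) : f (∑ j, c j * x j) i = f (c i) i * f (x i) i := by
    rw [map_sum, Finset.sum_apply, Finset.sum_eq_single i]
    · rw [map_mul, Pi.mul_apply]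
    · intro j _ hj
      rw [map_mul, Pi.mul_apply, hc0 j i hj.symm, zero_mul]
    · exact fun h => absurd (Finset.mem_univ i) h
  -- The separators `c j` act as idempotents up to units, gluing the componentwise fractions `p j`,
  -- `r j` into one.
  refine ⟨∑ j, c j * p j, ∑ j, c j * r j, Pi.isUnit_iff.2 fun i => ?_, funext fun i => ?_⟩
  · rw [hsum]
    exact (hcu i).mul (hp i)
  · rw [Pi.mul_apply, hsum, hsum, mul_assoc, e]

theorem isLeftOrderInProd_quotient_locRadical (hfin : (maxDen R).Finite)
    (hloc : ∀ (S : Submonoid R) (hS : S ∈ maxDen R),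
      IsWeaklyLeftLocalizable (LeftLocalization S hS.prop))
    (hnil : ∀ S ∈ maxDen R, ∀ T ∈ maxDen R, S ≠ T → ¬ ∀ a ∈ ass S, ∃ k : ℕ, a ^ k ∈ ass T) :
    IsLeftOrderInProd (R ⧸ locRadical R) := by
  have : Finite (maxDen R) := hfin
  let e := (Finite.equivFin (maxDen R)).symm
  let S (i : Fin (Nat.card (maxDen R))) : Submonoid R := e i
  have hS (i) : S i ∈ maxDen R := (e i).2
  have hA (i) := isNilOrUnitRing_leftLocalization (hS i) (hloc _ (hS i))
  have hSi (i) := unitPreimage_toLeftLocalization (hS i)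
  let σ : R →+* ∀ i, LeftLocalization (S i) (hS i).prop :=
    RingHom.pi fun i => toLeftLocalization (hS i).prop
  have hσ (r : R) : σ r = 0 ↔ r ∈ locRadical R := by
    rw [mem_locRadical, funext_iff]
    refine ⟨fun h T hT => ?_, fun h i => ?_⟩
    · obtain ⟨i, hi⟩ := e.surjective ⟨T, hT⟩
      obtain rfl : S i = T := congrArg Subtype.val hi
      exact (toLeftLocalization_eq_zero_iff _).1 (h i)
    · exact (toLeftLocalization_eq_zero_iff _).2 (h _ (hS i))
  let f := Ideal.Quotient.lift (locRadical R) σ fun r hr => (hσ r).2 hr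
  have hinj : Function.Injective f := by
    refine (injective_iff_map_eq_zero _).2 fun x hx => ?_
    obtain ⟨x, rfl⟩ := Ideal.Quotient.mk_surjective x
    exact Ideal.Quotient.eq_zero_iff_mem.2 ((hσ x).1 hx)
  refine ⟨_, _, _, hA, f, hinj, isLeftLocalizationMap_pi hinj (fun i => ?_) fun j => ?_⟩
  · have hi := isLeftLocalizationMap_toLeftLocalization (hS i).prop
    refine ⟨fun b => ?_, fun r hr => ?_⟩
    · obtain ⟨p, r, hp, h⟩ := hi.exists_mul_eq b
      exact ⟨Ideal.Quotient.mk _ p, Ideal.Quotient.mk _ r, hp, h⟩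
    · obtain ⟨r, rfl⟩ := Ideal.Quotient.mk_surjective r
      obtain ⟨p, hp, h⟩ := hi.exists_mul_eq_zero r hr
      exact ⟨Ideal.Quotient.mk _ p, hp, by rw [← map_mul, h, map_zero]⟩
  · have hsep (i j) (hij : i ≠ j) : ∃ a ∈ ass (S i), a ∈ S j := by
      have hne : S i ≠ S j := fun h => hij (e.injective (Subtype.ext h))
      have h := hnil _ (hS i) _ (hS j) hne
      push Not at h
      obtain ⟨a, ha, hk⟩ := h
      refine ⟨a, ha, ?_⟩
      rw [hSi j]
      -- Not being nil modulo `ass (S j)` means having non-nilpotent image in a nil-or-unit ring, so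
      -- `a` is inverted there and lies in `S j`.
      refine ((hA j).isNilpotent_or_isUnit _).resolve_left fun ⟨k, h⟩ => hk k ?_
      rwa [← toLeftLocalization_eq_zero_iff (hS j).prop, map_pow]
    obtain ⟨c, hc, h0⟩ := exists_mem_forall_mem_ass (fun i => (hS i).prop) hsep j
    exact ⟨Ideal.Quotient.mk _ c, le_unitPreimage_toLeftLocalization (hS j).prop hc,
      fun i hi => (toLeftLocalization_eq_zero_iff _).2 (h0 i hi)⟩

theorem isWeaklyLeftLocalizable_of_quotient
    (h : IsWeaklyLeftLocalizable (R ⧸ locRadical R))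
    (hnil : ∀ x ∈ locRadical R, IsNilpotent x)
    (himg : Ideal.Quotient.mk (locRadical R) '' localizable R = localizable (R ⧸ locRadical R)) :
    IsWeaklyLeftLocalizable R := by
  intro r hr
  have hr' : ¬ IsNilpotent (Ideal.Quotient.mk (locRadical R) r) := fun ⟨k, hk⟩ => by
    obtain ⟨l, hl⟩ := hnil (r ^ k) (Ideal.Quotient.eq_zero_iff_mem.1 (by rw [map_pow, hk]))
    exact hr ⟨k * l, by rw [pow_mul, hl]⟩
  obtain ⟨x, hx, e⟩ : _ ∈ Ideal.Quotient.mk (locRadical R) '' localizable R := himg ▸ h _ hr'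
  obtain ⟨S, hS, hx⟩ := mem_localizable_iff.1 hx
  refine mem_localizable_iff.2 ⟨S, hS, ?_⟩
  rw [← comap_map_mk hS]
  exact ⟨x, hx, e⟩

theorem weaklyLeftLocalizable_of_isLeftOrderInProd (h : IsLeftOrderInProd (R ⧸ locRadical R))
    (hnil : ∀ x ∈ locRadical R, IsNilpotent x)
    (himg : Ideal.Quotient.mk (locRadical R) '' localizable R = localizable (R ⧸ locRadical R)) :
    IsWeaklyLeftLocalizable R ∧ Function.Surjective (maxDenMap R) ∧ (maxDen R).Finite ∧
      (∀ (S : Submonoid R) (hS : S ∈ maxDen R),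
        IsWeaklyLeftLocalizable (LeftLocalization S hS.prop)) ∧
      (∀ S ∈ maxDen R, ∀ T ∈ maxDen R, S ≠ T → ¬ ∀ a ∈ ass S, ∃ k : ℕ, a ^ k ∈ ass T) := by
  obtain ⟨n, A, _, hA, f, hinj, hf⟩ := h
  have hnt (i) := (hA i).toNontrivial
  have hmax {T} := mem_maxDen_iff_of_injective hf hinj hA (T := T)
  have hmap {S : Submonoid R} (hS : S ∈ maxDen R) :
      ∃ i, S.map (Ideal.Quotient.mk (locRadical R)) = unitPreimage (component f i) :=
    hmax.1 (map_mem_maxDen R hS)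
  refine ⟨isWeaklyLeftLocalizable_of_quotient (fun r hr => ?_) hnil himg, fun ⟨T, hT⟩ => ?_,
    ?_, fun S hS => ?_, fun S hS T hT hne hST => ?_⟩
  · obtain ⟨i, hi⟩ := exists_isUnit_component hinj hA hr
    exact mem_localizable_iff.2 ⟨_, hmax.2 ⟨i, rfl⟩, hi⟩
  · obtain ⟨i, rfl⟩ := hmax.1 hT
    obtain ⟨r, hr, h0⟩ := hf.exists_component i
    have hrl : r ∈ localizable (R ⧸ locRadical R) := mem_localizable_iff.2 ⟨_, hT, hr⟩
    rw [← himg] at hrl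
    obtain ⟨x, hx, rfl⟩ := hrl
    obtain ⟨S, hS, hx⟩ := mem_localizable_iff.1 hx
    obtain ⟨j, hj⟩ := hmap hS
    -- The lift `x` is inverted in component `j`, but its image `r` is supported on component `i`.
    obtain rfl : j = i := by
      by_contra hji
      have hu : IsUnit (f (Ideal.Quotient.mk _ x) j) :=
        mem_unitPreimage.1 (hj ▸ Submonoid.mem_map_of_mem _ hx)
      rw [h0 j hji] at hu
      exact not_isUnit_zero hu
    exact ⟨⟨S, hS⟩, Subtype.ext hj⟩
  · have hfin : (maxDen (R ⧸ locRadical R)).Finite :=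
      (Set.finite_range fun i => unitPreimage (component f i)).subset fun T hT => by
        obtain ⟨i, rfl⟩ := hmax.1 hT
        exact ⟨i, rfl⟩
    have : Finite (maxDen (R ⧸ locRadical R)) := hfin
    exact Finite.of_injective _ (maxDenMap_injective (R := R))
  · obtain ⟨i, hi⟩ := hmap hS
    have hg := (hf.component i).comp_mk hS hi
    have hgS : unitPreimage ((component f i).comp (Ideal.Quotient.mk (locRadical R))) = S :=
      IsLeftLocalizationMap.unitPreimage_comp_mk hS hi
    generalize (component f i).comp (Ideal.Quotient.mk (locRadical R)) = g at hg hgS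
    subst hgS
    let := hS.prop.oreSet
    obtain ⟨e⟩ := hg.nonempty_ringEquiv
    exact ((hA i).of_ringEquiv e.symm).isWeaklyLeftLocalizable
  · obtain ⟨i, hi⟩ := hmap hS
    obtain ⟨j, hj⟩ := hmap hT
    have hij : i ≠ j := by
      rintro rfl
      exact hne (by rw [← comap_map_mk hS, hi, ← hj, comap_map_mk hT])
    -- A lift of an element supported on component `j` lies in `ass S` and in `T`; its powers stay
    -- in `T`, which misses `ass T`.
    obtain ⟨r, hr, h0⟩ := hf.exists_component j
    obtain ⟨a, rfl⟩ := Ideal.Quotient.mk_surjective r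
    have haS : a ∈ ass S := by
      rw [← IsLeftLocalizationMap.unitPreimage_comp_mk hS hi,
        ((hf.component i).comp_mk hS hi).mem_ass]
      exact h0 i hij
    have haT : a ∈ T := by
      rw [← comap_map_mk hT, hj]
      exact hr
    obtain ⟨k, hk⟩ := hST a haS
    exact hT.prop.notMem_ass (T.pow_mem haT k) hk

end Main

end LeftLoc

theorem mainTheorem2 (R : Type u) [Ring R] [Nontrivial R] :
    List.TFAE [
      LeftLoc.IsWeaklyLeftLocalizable R ∧
        Function.Surjective (LeftLoc.maxDenMap R) ∧
        (LeftLoc.maxDen R).Finite ∧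
        (∀ (S : Submonoid R) (hS : S ∈ LeftLoc.maxDen R),
          LeftLoc.IsWeaklyLeftLocalizable (LeftLoc.LeftLocalization S hS.prop)) ∧
        (∀ S ∈ LeftLoc.maxDen R, ∀ T ∈ LeftLoc.maxDen R, S ≠ T →
          ¬ ∀ a ∈ LeftLoc.ass S, ∃ k : ℕ, a ^ k ∈ LeftLoc.ass T),
      (∃ h : LeftLoc.IsLeftDenominatorSet (nonZeroDivisors (R ⧸ LeftLoc.locRadical R)),
          LeftLoc.IsFiniteProdOfNilLocal
            (LeftLoc.LeftLocalization (nonZeroDivisors (R ⧸ LeftLoc.locRadical R)) h)) ∧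
        (∀ x ∈ LeftLoc.locRadical R, IsNilpotent x) ∧
        Ideal.Quotient.mk (LeftLoc.locRadical R) '' LeftLoc.localizable R =
          LeftLoc.localizable (R ⧸ LeftLoc.locRadical R),
      LeftLoc.IsFiniteProdOfNilLocal
          (LeftLoc.LargestLeftQuotientRing (R ⧸ LeftLoc.locRadical R)) ∧
        (∀ x ∈ LeftLoc.locRadical R, IsNilpotent x) ∧
        Ideal.Quotient.mk (LeftLoc.locRadical R) '' LeftLoc.localizable R =
          LeftLoc.localizable (R ⧸ LeftLoc.locRadical R)] := by
  have := LeftLoc.nontrivial_quotient_locRadical (R := R)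
  rw [← LeftLoc.isLeftOrderInProd_iff_classical, ← LeftLoc.isLeftOrderInProd_iff_largest]
  tfae_have 1 → 2 := fun ⟨hR, hsurj, hfin, hloc, hnil⟩ =>
    ⟨LeftLoc.isLeftOrderInProd_quotient_locRadical hfin hloc hnil,
      fun _ => LeftLoc.isNilpotent_of_mem_locRadical hR, LeftLoc.image_localizable_eq hsurj⟩
  tfae_have 2 → 3 := id
  tfae_have 3 → 1 := fun ⟨h, hnil, himg⟩ =>
    LeftLoc.weaklyLeftLocalizable_of_isLeftOrderInProd h hnil himg
  tfae_finish
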